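/- \textbf{Proposition.} For every $A\in\mathbb R$ and $k\in\mathbb N$ there is a constant $C_0>0$, depending only on $A$ and $k$, such that the following holds for every $C\ge C_0$. Let $d\ge 1$ and $n\ge 0$ be integers, let $\delta>0$, and put $L = C\,[1+\log\max(n,d,1/\delta)]$. Let $\mu\in\mathbb R^d$ and let $\Sigma\in\mathbb R^{d\times d}$ be symmetric positive definite with $\Sigma^{-1}\preceq\frac1\delta\mathbb 1$. Let $X$ have law $\mathcal N(\mu,\Sigma)$, with Lebesgue density $p$. Let $f:\mathbb R^d\to\mathbb R$ be convex and Lipschitz, with Lipschitz constant polynomially bounded in $n$, $d$ and $1/\delta$ in the sense that $$\operatorname{Lip}(f)=\sup_{x\ne y}\frac{f(x)-f(y)}{\|x-y\|}\le A\,\max(n,d,1/\delta)^k .$$ For $\lambda>0$ define the surrogate $$s(z)=\mathbb E\left[\left(1-\tfrac1\lambda\right)f(X)+\tfrac1\lambda f\big((1-\lambda)X+\lambda z\big)\right],\qquad z\in\mathbb R^d,$$ and, since $f$ need not be twice differentiable, define the averaged Hessian in the sense of distributions by $\mathbb E[f''(X)]=\int_{\mathbb R^d}f(x)\,p''(x)\,dx$,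 where $''$ denotes the Hessian matrix. If $0<\lambda\le\frac1{dL^2}$, then $$\mathbb E[f''(X)]\preceq\frac{2\,s''(\mu)}{\lambda}+\delta\left(\Sigma^{-1}+\mathbb 1\right),$$ where $\preceq$ is the Loewner order on symmetric matrices. -/

import Mathlib

open MeasureTheory ProbabilityTheory Matrix
open scoped NNReal MatrixOrder

noncomputable section

/-- The logarithmic factor `L = C (1 + log max(n, d, 1/δ))`. -/
def logFactor (C : ℝ) (n d : ℕ) (δ : ℝ) : ℝ :=
  C * (1 + Real.log (max (max (n : ℝ) (d : ℝ)) (1 / δ)))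

/-- The Hessian matrix `g''(x)` of `g : ℝ^d → ℝ`, with entries `∂ᵢ ∂ⱼ g (x)`. -/
def hessian {d : ℕ} (g : EuclideanSpace ℝ (Fin d) → ℝ) (x : EuclideanSpace ℝ (Fin d)) :
    Matrix (Fin d) (Fin d) ℝ :=
  Matrix.of fun i j =>
    fderiv ℝ (fderiv ℝ g) x (EuclideanSpace.single i 1) (EuclideanSpace.single j 1)

/-- The Lebesgue density of the Gaussian law `N(μ, S)` on `ℝ^d`, for positive definite `S`. -/
def gaussianDensity {d : ℕ} (μ : EuclideanSpace ℝ (Fin d)) (S : Matrix (Fin d) (Fin d) ℝ)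
    (x : EuclideanSpace ℝ (Fin d)) : ℝ :=
  (Real.sqrt ((2 * Real.pi) ^ d * S.det))⁻¹ *
    Real.exp (-((x - μ).ofLp ⬝ᵥ (S⁻¹ *ᵥ (x - μ).ofLp)) / 2)

theorem stdGaussian_eq_withDensity (d : ℕ) :
    stdGaussian (EuclideanSpace ℝ (Fin d)) = volume.withDensity
      (fun x => ENNReal.ofReal ((Real.sqrt ((2 * Real.pi) ^ d))⁻¹ * Real.exp (-(‖x‖ ^ 2) / 2))) := by
  have hI : Integrable (fun x : EuclideanSpace ℝ (Fin d) =>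
      (Real.sqrt ((2 * Real.pi) ^ d))⁻¹ * Real.exp (-(‖x‖ ^ 2) / 2)) := by
    have := (GaussianFourier.integrable_cexp_neg_mul_sq_norm_add (V := EuclideanSpace ℝ (Fin d))
      (b := 1/2) (by norm_num) 0 0).norm.const_mul (Real.sqrt ((2 * Real.pi) ^ d))⁻¹
    refine this.congr (.of_forall fun x => ?_)
    have h : (-(1 / 2 : ℂ) * (‖x‖ : ℂ) ^ 2 + 0 * (inner ℝ 0 x : ℝ)) = ((-(‖x‖ ^ 2) / 2 : ℝ) : ℂ) := by
      push_cast; ring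
    simp only []
    rw [h, Complex.norm_exp_ofReal]
  have : IsFiniteMeasure ((volume : Measure (EuclideanSpace ℝ (Fin d))).withDensity
      (fun x => ENNReal.ofReal ((Real.sqrt ((2 * Real.pi) ^ d))⁻¹ * Real.exp (-(‖x‖ ^ 2) / 2)))) :=
    isFiniteMeasure_withDensity_ofReal hI.2
  apply Measure.ext_of_charFun
  ext t
  rw [charFun_stdGaussian, charFun_apply,
    integral_withDensity_eq_integral_toReal_smul (by fun_prop) (.of_forall fun _ => ENNReal.ofReal_lt_top)]
  have h := GaussianFourier.integral_cexp_neg_mul_sq_norm_add (V := EuclideanSpace ℝ (Fin d))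
    (b := 1/2) (by norm_num) Complex.I t
  have e : ∀ x : EuclideanSpace ℝ (Fin d),
      (ENNReal.ofReal ((Real.sqrt ((2 * Real.pi) ^ d))⁻¹ * Real.exp (-(‖x‖ ^ 2) / 2))).toReal •
        Complex.exp (inner ℝ x t * Complex.I) = ((Real.sqrt ((2 * Real.pi) ^ d))⁻¹ : ℝ) *
        Complex.exp (-(1 / 2 : ℂ) * (‖x‖ : ℂ) ^ 2 + Complex.I * (inner ℝ t x : ℝ)) := by
    intro x
    rw [ENNReal.toReal_ofReal (by positivity), Complex.real_smul, Complex.ofReal_mul,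
      Complex.ofReal_exp, mul_assoc, ← Complex.exp_add, real_inner_comm]
    congr 2
    push_cast; ring
  simp_rw [e]
  rw [integral_const_mul, h]
  have h2 : ((Real.pi : ℂ) / (1 / 2)) ^ ((Module.finrank ℝ (EuclideanSpace ℝ (Fin d)) : ℂ) / 2)
      = ((Real.sqrt ((2 * Real.pi) ^ d) : ℝ) : ℂ) := by
    rw [Real.sqrt_eq_rpow, ← Real.rpow_natCast, ← Real.rpow_mul (by positivity),
      Complex.ofReal_cpow (by positivity)]
    simp
    congr 1
    ring
  rw [h2, ← mul_assoc, ← Complex.ofReal_mul, inv_mul_cancel₀ (by positivity)]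
  simp
  congr 1
  ring

/-- `gaussianDensity μ S` is the density of the Gaussian law `N(μ, S)`. -/
theorem multivariateGaussian_eq_withDensity {d : ℕ} (μ : EuclideanSpace ℝ (Fin d))
    {S : Matrix (Fin d) (Fin d) ℝ} (hS : S.PosDef) :
    multivariateGaussian μ S =
      volume.withDensity (fun x => ENNReal.ofReal (gaussianDensity μ S x)) := by
  set A : Matrix (Fin d) (Fin d) ℝ := CFC.sqrt S with hA
  have hAA : A * A = S := CFC.sqrt_mul_sqrt_self S hS.posSemidef.nonneg
  have hdS : 0 < S.det := hS.det_pos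
  have hdA2 : A.det * A.det = S.det := by rw [← Matrix.det_mul, hAA]
  have hdA : A.det ≠ 0 := by
    intro h; rw [h] at hdA2; simp at hdA2; exact hdS.ne hdA2
  have hu : IsUnit A.det := isUnit_iff_ne_zero.2 hdA
  have hAt : Aᵀ = A := by
    have := (CFC.sqrt_nonneg S)
    have h := (Matrix.nonneg_iff_posSemidef.1 this).isHermitian
    rwa [Matrix.IsHermitian, Matrix.conjTranspose_eq_transpose_of_trivial] at h
  have habs : |A.det| = Real.sqrt S.det := by
    rw [← hdA2, Real.sqrt_mul_self_eq_abs]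
  set T : EuclideanSpace ℝ (Fin d) → EuclideanSpace ℝ (Fin d) :=
    fun x => μ + toEuclideanCLM (𝕜 := ℝ) A x with hT
  have hTm : Measurable T := by fun_prop
  have hdet : (toEuclideanCLM (𝕜 := ℝ) A).det = A.det := by
    rw [ContinuousLinearMap.det]
    rw [show ((toEuclideanCLM (𝕜 := ℝ) A : EuclideanSpace ℝ (Fin d) →L[ℝ] EuclideanSpace ℝ (Fin d))
      : EuclideanSpace ℝ (Fin d) →ₗ[ℝ] EuclideanSpace ℝ (Fin d)) = Matrix.toEuclideanLin A from rfl]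
    rw [Matrix.toEuclideanLin_eq_toLin_orthonormal, LinearMap.det_toLin]
  have hinv : ∀ x, toEuclideanCLM (𝕜 := ℝ) A⁻¹ (toEuclideanCLM (𝕜 := ℝ) A x) = x := by
    intro x
    rw [← mul_apply_eq_comp, ← map_mul, Matrix.nonsing_inv_mul A hu, map_one]; rfl
  have hinv' : ∀ x, toEuclideanCLM (𝕜 := ℝ) A (toEuclideanCLM (𝕜 := ℝ) A⁻¹ x) = x := by
    intro x
    rw [← mul_apply_eq_comp, ← map_mul, Matrix.mul_nonsing_inv A hu, map_one]; rfl
  have hinj : Function.Injective T := by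
    intro x y h
    have : toEuclideanCLM (𝕜 := ℝ) A x = toEuclideanCLM (𝕜 := ℝ) A y := by simpa [hT] using h
    rw [← hinv x, this, hinv]
  have hsurj : Function.Surjective T := fun y =>
    ⟨toEuclideanCLM (𝕜 := ℝ) A⁻¹ (y - μ), by simp only [hT, hinv']; abel⟩
  have hvol := map_withDensity_abs_det_fderiv_eq_addHaar (s := Set.univ) (f := T)
    (f' := fun _ => toEuclideanCLM (𝕜 := ℝ) A) (volume : Measure (EuclideanSpace ℝ (Fin d)))
    MeasurableSet.univ.nullMeasurableSet
    (fun x _ => ((toEuclideanCLM (𝕜 := ℝ) A).hasFDerivAt.const_add μ).hasFDerivWithinAt)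
    hinj.injOn
  rw [Set.image_univ, hsurj.range_eq, Measure.restrict_univ, hdet, habs] at hvol
  have hp : Measurable fun x => ENNReal.ofReal (gaussianDensity μ S x) := by
    unfold gaussianDensity
    have : Continuous fun x : EuclideanSpace ℝ (Fin d) =>
        (x - μ).ofLp ⬝ᵥ (S⁻¹ *ᵥ (x - μ).ofLp) := by
      fun_prop
    fun_prop
  have hquad : ∀ x : EuclideanSpace ℝ (Fin d),
      (T x - μ).ofLp ⬝ᵥ (S⁻¹ *ᵥ (T x - μ).ofLp) = ‖x‖ ^ 2 := by
    intro x
    have h1 : (T x - μ).ofLp = A *ᵥ x.ofLp := by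
      simp only [hT, add_sub_cancel_left]; rfl
    rw [h1, ← hAA, Matrix.mul_inv_rev, Matrix.mulVec_mulVec, Matrix.mul_assoc,
      Matrix.nonsing_inv_mul A hu, Matrix.mul_one, Matrix.dotProduct_mulVec,
      ← Matrix.vecMul_transpose, hAt, Matrix.vecMul_vecMul, Matrix.mul_nonsing_inv A hu,
      Matrix.vecMul_one, EuclideanSpace.real_norm_sq_eq, dotProduct]
    exact Finset.sum_congr rfl fun i _ => (pow_two _).symm
  rw [multivariateGaussian, stdGaussian_eq_withDensity]
  refine Measure.ext fun s hs => ?_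
  rw [Measure.map_apply hTm hs, withDensity_apply _ (hTm hs), withDensity_apply _ hs]
  conv_rhs => rw [← hvol]
  rw [setLIntegral_map hs hp hTm, withDensity_const, Measure.restrict_smul, lintegral_smul_measure,
    smul_eq_mul,
    ← lintegral_const_mul _ (show Measurable fun a => ENNReal.ofReal (gaussianDensity μ S (T a))
      from hp.comp hTm)]
  refine lintegral_congr fun x => ?_
  rw [← ENNReal.ofReal_mul (by positivity), gaussianDensity, hquad,
    Real.sqrt_mul (by positivity), mul_inv, neg_div]
  congr 1
  have : Real.sqrt S.det ≠ 0 := by positivity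
  field_simp

/-- The matrix `E[f''(X)]` for `X` with law `N(μ, S)` and a (possibly non-smooth) function `f`
on `ℝ^d`, in the sense of distributions: `E[f''(X)] = ∫ f(x) p''(x) dx`, where `p` is the density
of `N(μ, S)`. -/
def expectedHessian {d : ℕ} (μ : EuclideanSpace ℝ (Fin d)) (S : Matrix (Fin d) (Fin d) ℝ)
    (f : EuclideanSpace ℝ (Fin d) → ℝ) : Matrix (Fin d) (Fin d) ℝ :=
  Matrix.of fun i j => ∫ x, f x * hessian (gaussianDensity μ S) x i j

/-- The surrogate `s(z) = E[(1 - 1/lam) f(X) + (1/lam) f((1 - lam) X + lam z)]` with `X` of law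
`N(μ, S)`. -/
def surrogate {d : ℕ} (lam : ℝ) (μ : EuclideanSpace ℝ (Fin d)) (S : Matrix (Fin d) (Fin d) ℝ)
    (f : EuclideanSpace ℝ (Fin d) → ℝ) (z : EuclideanSpace ℝ (Fin d)) : ℝ :=
  ∫ x, ((1 - 1 / lam) * f x + 1 / lam * f ((1 - lam) • x + lam • z)) ∂(multivariateGaussian μ S)

end

/-!
Write `p` for the density of `X ∼ N(μ, S)`, `q` for that of the contracted law
`N(μ, (1 - lam)² S)` and `r` for that of the dilated law `N(μ, 4 S)`.

Up to additive and multiplicative constants, the surrogate is `f` smeared by `q`, evaluated at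
`lam • (z - μ)` (`surrogate_eq_smear`), and the chain rule gives `s''(μ) = lam * ∫ f q''`
(`hessian_surrogate`). The claim is therefore a comparison of the averages of `f''` against `p` and
against `2 q`.

For convex `f` the averaged Hessian is monotone in the averaging kernel: if `p ≤ 2 q + ε r`, then
`h ↦ ∫ f(x + h) (2 q + ε r - p)(x) dx` is convex, so its Hessian at the origin is positive
semidefinite (`smear_fderiv_fderiv_le_of_le`). No second derivative of `f` is needed.

The pointwise inequality holds with `ε = 2 ^ d exp (-3 / (64 lam))`
(`gaussianDensity_le_contracted_add_dilated`): where the squared Mahalanobis distance to `μ` is at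
most `1 / (8 lam)` the ratio `p / q` is at most `2`, and beyond that `p ≤ ε r`.

The remaining term `ε ∫ f r''` is small. Moving one derivative onto `f` bounds `∫ f r''` by
`K / 2` times the sum of the identity and the precision matrix of `r`
(`dotProduct_expectedHessian_mulVec_le`), and
`1 / lam ≥ d L²` makes `ε` smaller than any fixed power of `1 / max(n, d, 1/δ)`
(`dilated_weight_le`), so that `K ε ≤ δ`.
-/

/-! ### Smearing a Lipschitz function by a rapidly decaying kernel -/

section Smear

theorem LipschitzWith.exists_abs_le_mul_exp_norm {E : Type*} [NormedAddCommGroup E]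
    {f : E → ℝ} {K : ℝ≥0} (hf : LipschitzWith K f) :
    ∃ a : ℝ, 0 ≤ a ∧ ∀ x, |f x| ≤ a * Real.exp ‖x‖ := by
  refine ⟨|f 0| + K, by positivity, fun x => ?_⟩
  have h1 : |f x - f 0| ≤ K * ‖x‖ := by
    simpa [dist_eq_norm] using hf.dist_le_mul x 0
  have h2 : |f x| ≤ |f 0| + K * ‖x‖ := by
    calc |f x| = |f 0 + (f x - f 0)| := by ring_nf
      _ ≤ _ := (abs_add_le _ _).trans (by gcongr)
  have h3 : ‖x‖ + 1 ≤ Real.exp ‖x‖ := Real.add_one_le_exp _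
  have h4 := norm_nonneg x
  calc |f x| ≤ |f 0| * 1 + K * ‖x‖ := by linarith
    _ ≤ |f 0| * Real.exp ‖x‖ + K * Real.exp ‖x‖ := by gcongr <;> linarith
    _ = _ := by ring

variable {E F : Type*} [NormedAddCommGroup E] [NormedSpace ℝ E]
  [NormedAddCommGroup F] [NormedSpace ℝ F]

/-- `φ` decays like `exp (-2‖x‖)`. The rate `2` leaves a factor `exp (-‖x‖)` to spare after
multiplication by a function of at most linear growth. -/
def ExpDecay (φ : E → F) : Prop :=
  ∃ C : ℝ, 0 ≤ C ∧ ∀ x, ‖φ x‖ ≤ C * Real.exp (-(2 * ‖x‖))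

/-- `φ` is twice continuously differentiable and decays exponentially together with its
derivatives of order one and two. -/
structure DecayingC2 (φ : E → F) : Prop where
  contDiff : ContDiff ℝ 2 φ
  decay : ExpDecay φ
  decay_fderiv : ExpDecay (fderiv ℝ φ)
  decay_fderiv_fderiv : ExpDecay (fderiv ℝ (fderiv ℝ φ))

/-- The correlation `h ↦ ∫ f(x) φ(x - h) dx = ∫ f(x + h) φ(x) dx` of `f` with the kernel `φ`. -/
noncomputable def smear {E F : Type*} [NormedAddCommGroup E] [NormedAddCommGroup F]
    [NormedSpace ℝ F] [MeasurableSpace E] (ν : Measure E) (f : E → ℝ) (φ : E → F) (h : E) : F :=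
  ∫ x, f x • φ (x - h) ∂ν

theorem ExpDecay.norm_smul_comp_sub_le {E : Type*} [NormedAddCommGroup E] {φ : E → F}
    (hφ : ExpDecay φ) {f : E → ℝ} {K : ℝ≥0}
    (hf : LipschitzWith K f) (r : ℝ) :
    ∃ C : ℝ, ∀ h x : E, ‖h‖ ≤ r → ‖f x • φ (x - h)‖ ≤ C * Real.exp (-‖x‖) := by
  obtain ⟨C, hC0, hC⟩ := hφ
  obtain ⟨a, ha0, ha⟩ := hf.exists_abs_le_mul_exp_norm
  refine ⟨a * C * Real.exp (2 * r), fun h x hh => ?_⟩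
  have h1 : ‖x‖ - r ≤ ‖x - h‖ := by linarith [norm_sub_norm_le x h]
  calc ‖f x • φ (x - h)‖ = |f x| * ‖φ (x - h)‖ := by rw [norm_smul, Real.norm_eq_abs]
    _ ≤ (a * Real.exp ‖x‖) * (C * Real.exp (-(2 * ‖x - h‖))) := by
        gcongr
        · exact ha x
        · exact hC _
    _ ≤ (a * Real.exp ‖x‖) * (C * Real.exp (2 * r - 2 * ‖x‖)) := by
        gcongr; linarith
    _ = _ := by
        rw [show (2 * r - 2 * ‖x‖) = 2 * r + -‖x‖ + -‖x‖ by ring, Real.exp_add, Real.exp_add,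
          Real.exp_neg]
        field_simp

theorem smear_eq_integral_comp_add {E F : Type*} [NormedAddCommGroup E] [NormedAddCommGroup F]
    [NormedSpace ℝ F] [MeasurableSpace E] [BorelSpace E] (ν : Measure E) [ν.IsAddRightInvariant]
    (f : E → ℝ) (φ : E → F) (h : E) :
    smear ν f φ h = ∫ x, f (x + h) • φ x ∂ν := by
  rw [smear, ← integral_add_right_eq_self _ h]
  simp

variable [FiniteDimensional ℝ E] [MeasurableSpace E] [BorelSpace E]
  (ν : Measure E) [ν.IsAddHaarMeasure]

theorem integrable_exp_neg_norm : Integrable (fun x : E => Real.exp (-‖x‖)) ν := by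
  set N := Module.finrank ℝ E + 1
  have h : Integrable (fun x : E => (1 + ‖x‖) ^ (-(N : ℝ))) ν :=
    integrable_one_add_norm (by simp [N])
  refine (h.const_mul (N.factorial * Real.exp 1)).mono' (by fun_prop) (.of_forall fun x => ?_)
  have h0 : 0 < 1 + ‖x‖ := by positivity
  have := Real.pow_div_factorial_le_exp _ h0.le N
  rw [div_le_iff₀ (by positivity), Real.exp_add] at this
  rw [Real.norm_of_nonneg (Real.exp_pos _).le, Real.rpow_neg h0.le, Real.rpow_natCast,
    ← div_eq_mul_inv, le_div_iff₀ (by positivity), Real.exp_neg]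
  calc (Real.exp ‖x‖)⁻¹ * (1 + ‖x‖) ^ N
      ≤ (Real.exp ‖x‖)⁻¹ * (Real.exp 1 * Real.exp ‖x‖ * N.factorial) := by gcongr
    _ = _ := by field_simp

theorem ExpDecay.integrable_smul_comp_sub {φ : E → F} (hφ : ExpDecay φ) (hc : Continuous φ)
    {f : E → ℝ} {K : ℝ≥0} (hf : LipschitzWith K f) (h : E) :
    Integrable (fun x => f x • φ (x - h)) ν := by
  obtain ⟨C, hC⟩ := hφ.norm_smul_comp_sub_le hf ‖h‖
  have hfc := hf.continuous
  exact ((integrable_exp_neg_norm ν).const_mul C).mono'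
    (Continuous.aestronglyMeasurable (by fun_prop)) (.of_forall fun x => hC h x le_rfl)

theorem ExpDecay.integrable_smul {φ : E → F} (hφ : ExpDecay φ) (hc : Continuous φ)
    {f : E → ℝ} {K : ℝ≥0} (hf : LipschitzWith K f) :
    Integrable (fun x => f x • φ x) ν := by
  simpa using hφ.integrable_smul_comp_sub ν hc hf 0

theorem ExpDecay.integrable {φ : E → F} (hφ : ExpDecay φ) (hc : Continuous φ) :
    Integrable φ ν := by
  simpa using hφ.integrable_smul ν hc (LipschitzWith.const (1 : ℝ) (α := E))

/-- Differentiation of a smeared function falls on the kernel. -/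
theorem hasFDerivAt_smear {φ : E → F} (hφ : ContDiff ℝ 1 φ) (h0 : ExpDecay φ)
    (h1 : ExpDecay (fderiv ℝ φ)) {f : E → ℝ} {K : ℝ≥0} (hf : LipschitzWith K f) (h : E) :
    HasFDerivAt (smear ν f φ) (-smear ν f (fderiv ℝ φ) h) h := by
  obtain ⟨C, hC⟩ := h1.norm_smul_comp_sub_le hf (‖h‖ + 1)
  have hfc := hf.continuous
  have hφc := hφ.continuous
  have hφ'c : Continuous (fderiv ℝ φ) := hφ.continuous_fderiv one_ne_zero
  have key := hasFDerivAt_integral_of_dominated_of_fderiv_le (𝕜 := ℝ) (μ := ν)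
    (F := fun h x => f x • φ (x - h)) (F' := fun h x => -(f x • fderiv ℝ φ (x - h)))
    (bound := fun x => C * Real.exp (-‖x‖)) (Metric.ball_mem_nhds h one_pos)
    (.of_forall fun x => Continuous.aestronglyMeasurable (by fun_prop))
    (h0.integrable_smul_comp_sub ν hφc hf h)
    (Continuous.aestronglyMeasurable (by fun_prop))
    (.of_forall fun x y hy => by
      rw [norm_neg]
      refine hC y x ?_
      rw [Metric.mem_ball, dist_eq_norm] at hy
      linarith [norm_le_norm_add_norm_sub' y h])
    ((integrable_exp_neg_norm ν).const_mul C)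
    (.of_forall fun x y _ => by
      have hd : HasFDerivAt φ (fderiv ℝ φ (x - y)) (x - y) :=
        (hφ.differentiable one_ne_zero _).hasFDerivAt
      have := (hd.comp y ((hasFDerivAt_id y).const_sub x)).const_smul (f x)
      refine this.congr_fderiv ?_
      ext v
      simp [-map_sub])
  rw [integral_neg] at key
  exact key

end Smear

/-! ### Second derivatives of smeared functions -/

section SecondOrder

theorem LipschitzWith.comp_add_const {E : Type*} [SeminormedAddCommGroup E] {f : E → ℝ}
    {K : ℝ≥0} (hf : LipschitzWith K f) (h : E) : LipschitzWith K fun x => f (x + h) :=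
  .of_dist_le_mul fun x y => by simpa using hf.dist_le_mul (x + h) (y + h)

variable {E : Type*} [NormedAddCommGroup E] [NormedSpace ℝ E]
  [FiniteDimensional ℝ E] [MeasurableSpace E] [BorelSpace E]
  {ν : Measure E} [ν.IsAddHaarMeasure] {f : E → ℝ} {K : ℝ≥0}

theorem DecayingC2.continuous_fderiv_fderiv {E : Type*} [NormedAddCommGroup E]
    [NormedSpace ℝ E] {φ : E → ℝ} (hφ : DecayingC2 φ) :
    Continuous (fderiv ℝ (fderiv ℝ φ)) :=
  (hφ.contDiff.fderiv_right (m := 1) (by norm_num)).continuous_fderiv one_ne_zero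

theorem DecayingC2.hasFDerivAt_smear {φ : E → ℝ} (hφ : DecayingC2 φ) (hf : LipschitzWith K f)
    (h : E) : HasFDerivAt (smear ν f φ) (-smear ν f (fderiv ℝ φ) h) h :=
  _root_.hasFDerivAt_smear ν (hφ.contDiff.of_le (by norm_num)) hφ.decay hφ.decay_fderiv hf h

theorem DecayingC2.hasFDerivAt_smear_fderiv {φ : E → ℝ} (hφ : DecayingC2 φ)
    (hf : LipschitzWith K f) (h : E) :
    HasFDerivAt (smear ν f (fderiv ℝ φ)) (-smear ν f (fderiv ℝ (fderiv ℝ φ)) h) h :=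
  _root_.hasFDerivAt_smear ν (hφ.contDiff.fderiv_right (by norm_num)) hφ.decay_fderiv
    hφ.decay_fderiv_fderiv hf h

theorem DecayingC2.fderiv_smear {φ : E → ℝ} (hφ : DecayingC2 φ) (hf : LipschitzWith K f) :
    fderiv ℝ (smear ν f φ) = fun h => -smear ν f (fderiv ℝ φ) h :=
  funext fun h => (hφ.hasFDerivAt_smear hf h).fderiv

theorem DecayingC2.fderiv_fderiv_smear {φ : E → ℝ} (hφ : DecayingC2 φ) (hf : LipschitzWith K f)
    (h : E) :
    fderiv ℝ (fderiv ℝ (smear ν f φ)) h = smear ν f (fderiv ℝ (fderiv ℝ φ)) h := by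
  rw [hφ.fderiv_smear hf]
  simpa using (hφ.hasFDerivAt_smear_fderiv (ν := ν) hf h).fun_neg.fderiv

theorem DecayingC2.smear_fderiv_fderiv_apply {φ : E → ℝ} (hφ : DecayingC2 φ)
    (hf : LipschitzWith K f) (u v : E) :
    smear ν f (fderiv ℝ (fderiv ℝ φ)) 0 u v = ∫ x, f x * fderiv ℝ (fderiv ℝ φ) x u v ∂ν := by
  have hi := hφ.decay_fderiv_fderiv.integrable_smul ν hφ.continuous_fderiv_fderiv hf
  simp only [smear, sub_zero]
  rw [ContinuousLinearMap.integral_apply hi, ContinuousLinearMap.integral_apply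
    (hi.apply_continuousLinearMap u)]
  rfl

theorem DecayingC2.hasDerivAt_smear_line {φ : E → ℝ} (hφ : DecayingC2 φ)
    (hf : LipschitzWith K f) (v : E) (t : ℝ) :
    HasDerivAt (fun t : ℝ => smear ν f φ (t • v)) (-smear ν f (fderiv ℝ φ) (t • v) v) t := by
  have h := (hφ.hasFDerivAt_smear (ν := ν) hf (t • v)).comp_hasDerivAt t
    ((hasDerivAt_id t).smul_const v)
  simpa [Function.comp_def] using h

theorem DecayingC2.hasDerivAt_smear_fderiv_line {φ : E → ℝ} (hφ : DecayingC2 φ)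
    (hf : LipschitzWith K f) (v : E) :
    HasDerivAt (fun t : ℝ => -smear ν f (fderiv ℝ φ) (t • v) v)
      (smear ν f (fderiv ℝ (fderiv ℝ φ)) 0 v v) 0 := by
  have h := (hφ.hasFDerivAt_smear_fderiv (ν := ν) hf ((0 : ℝ) • v)).comp_hasDerivAt (0 : ℝ)
    ((hasDerivAt_id (0 : ℝ)).smul_const v)
  have h2 := (h.clm_apply (hasDerivAt_const (0 : ℝ) v)).fun_neg
  simpa [Function.comp_def] using h2

/-- For convex `f`, the averaged Hessian is monotone in the averaging kernel, since
`h ↦ ∫ f(x + h) g(x) dx` is convex for every kernel `g ≥ 0`. -/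
theorem smear_fderiv_fderiv_le_of_le (hconv : ConvexOn ℝ Set.univ f) (hf : LipschitzWith K f)
    {p q r : E → ℝ} (hp : DecayingC2 p) (hq : DecayingC2 q) (hr : DecayingC2 r) {a b : ℝ}
    (hle : ∀ x, p x ≤ a * q x + b * r x) (v : E) :
    smear ν f (fderiv ℝ (fderiv ℝ p)) 0 v v ≤
      a * smear ν f (fderiv ℝ (fderiv ℝ q)) 0 v v +
        b * smear ν f (fderiv ℝ (fderiv ℝ r)) 0 v v := by
  set Φ : ℝ → ℝ := fun t =>
    a * smear ν f q (t • v) + b * smear ν f r (t • v) - smear ν f p (t • v) with hΦ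
  have hΦ1 : ∀ t, HasDerivAt Φ (a * (-smear ν f (fderiv ℝ q) (t • v) v) +
      b * (-smear ν f (fderiv ℝ r) (t • v) v) - (-smear ν f (fderiv ℝ p) (t • v) v)) t := fun t =>
    (((hq.hasDerivAt_smear_line hf v t).const_mul a).add
      ((hr.hasDerivAt_smear_line hf v t).const_mul b)).sub (hp.hasDerivAt_smear_line hf v t)
  have hΦ2 : HasDerivAt (deriv Φ) (a * smear ν f (fderiv ℝ (fderiv ℝ q)) 0 v v +
      b * smear ν f (fderiv ℝ (fderiv ℝ r)) 0 v v - smear ν f (fderiv ℝ (fderiv ℝ p)) 0 v v) 0 := by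
    rw [show deriv Φ = _ from funext fun t => (hΦ1 t).deriv]
    exact (((hq.hasDerivAt_smear_fderiv_line hf v).const_mul a).add
      ((hr.hasDerivAt_smear_fderiv_line hf v).const_mul b)).sub
      (hp.hasDerivAt_smear_fderiv_line hf v)
  have hint : ∀ {φ : E → ℝ}, DecayingC2 φ → ∀ h : E, Integrable (fun x => f (x + h) • φ x) ν :=
    fun hφ h => hφ.decay.integrable_smul ν hφ.contDiff.continuous (hf.comp_add_const h)
  have hΦeq : ∀ t, Φ t = ∫ x, f (x + t • v) * (a * q x + b * r x - p x) ∂ν := fun t => by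
    simp only [hΦ, smear_eq_integral_comp_add]
    rw [← integral_const_mul, ← integral_const_mul,
      ← integral_add ((hint hq _).const_mul a) ((hint hr _).const_mul b),
      ← integral_sub (((hint hq _).const_mul a).fun_add ((hint hr _).const_mul b)) (hint hp _)]
    refine integral_congr_ae (.of_forall fun x => ?_)
    simp only [smul_eq_mul]
    ring
  have hgi : ∀ t : ℝ, Integrable (fun x => f (x + t • v) * (a * q x + b * r x - p x)) ν :=
    fun t => by
    refine ((((hint hq (t • v)).const_mul a).add ((hint hr (t • v)).const_mul b)).sub
      (hint hp (t • v))).congr (.of_forall fun x => ?_)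
    simp only [Pi.add_apply, Pi.sub_apply, smul_eq_mul]
    ring
  have hΦc : ConvexOn ℝ Set.univ Φ := by
    refine ⟨convex_univ, fun s _ t _ α β hα hβ hαβ => ?_⟩
    simp only [hΦeq, smul_eq_mul]
    rw [← integral_const_mul, ← integral_const_mul,
      ← integral_add ((hgi s).const_mul α) ((hgi t).const_mul β)]
    refine integral_mono (by simpa using hgi (α * s + β * t))
      (((hgi s).const_mul α).add ((hgi t).const_mul β)) fun x => ?_
    have hx := hconv.2 (Set.mem_univ (x + s • v)) (Set.mem_univ (x + t • v)) hα hβ hαβ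
    have he : α • (x + s • v) + β • (x + t • v) = x + (α * s + β * t) • v := by
      calc _ = (α + β) • x + (α * s + β * t) • v := by module
        _ = _ := by rw [hαβ, one_smul]
    rw [he, smul_eq_mul, smul_eq_mul] at hx
    have := mul_le_mul_of_nonneg_right hx (sub_nonneg.2 (hle x))
    simp only
    linarith
  have hmono : Monotone (deriv Φ) := by
    rw [← monotoneOn_univ]
    exact hΦc.monotoneOn_deriv fun t _ => (hΦ1 t).differentiableAt
  have := hmono.deriv_nonneg (x := 0)
  rw [hΦ2.deriv] at this
  linarith

/-- One derivative falls on the kernel and the other on the Lipschitz function. -/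
theorem DecayingC2.smear_fderiv_fderiv_le {φ : E → ℝ} (hφ : DecayingC2 φ)
    (hf : LipschitzWith K f) (v : E) :
    smear ν f (fderiv ℝ (fderiv ℝ φ)) 0 v v ≤ K * ‖v‖ * ∫ x, |fderiv ℝ φ x v| ∂ν := by
  have hc : Continuous (fderiv ℝ φ) := hφ.contDiff.continuous_fderiv two_ne_zero
  have hi : Integrable (fun x => |fderiv ℝ φ x v|) ν :=
    ((hφ.decay_fderiv.integrable ν hc).apply_continuousLinearMap v).abs
  have hI0 : 0 ≤ ∫ x, |fderiv ℝ φ x v| ∂ν := integral_nonneg fun x => abs_nonneg _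
  have hint : ∀ h : E, Integrable (fun x => f (x + h) • fderiv ℝ φ x) ν :=
    fun h => hφ.decay_fderiv.integrable_smul ν hc (hf.comp_add_const h)
  set M : ℝ≥0 := ⟨K * ‖v‖ * ∫ x, |fderiv ℝ φ x v| ∂ν, by positivity⟩
  have hlip : LipschitzWith M (fun t : ℝ => -smear ν f (fderiv ℝ φ) (t • v) v) := by
    refine LipschitzWith.of_dist_le_mul fun s t => ?_
    have he : ∀ t : ℝ, smear ν f (fderiv ℝ φ) (t • v) v =
        ∫ x, f (x + t • v) * fderiv ℝ φ x v ∂ν := fun t => by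
      rw [smear_eq_integral_comp_add, ContinuousLinearMap.integral_apply (hint _)]
      rfl
    have hi' : ∀ t : ℝ, Integrable (fun x => f (x + t • v) * fderiv ℝ φ x v) ν := fun t =>
      (hint (t • v)).apply_continuousLinearMap v
    rw [dist_neg_neg, he, he, dist_eq_norm, ← integral_sub (hi' s) (hi' t)]
    calc ‖∫ x, (f (x + s • v) * fderiv ℝ φ x v - f (x + t • v) * fderiv ℝ φ x v) ∂ν‖
        ≤ ∫ x, (K * (dist s t * ‖v‖)) * |fderiv ℝ φ x v| ∂ν := by
          refine norm_integral_le_of_norm_le (hi.const_mul _) (.of_forall fun x => ?_)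
          rw [← sub_mul, norm_mul, Real.norm_eq_abs, Real.norm_eq_abs]
          gcongr
          have := hf.dist_le_mul (x + s • v) (x + t • v)
          rw [dist_add_left, dist_eq_norm (s • v), ← sub_smul, norm_smul, ← dist_eq_norm] at this
          exact this
      _ = M * dist s t := by
          rw [integral_const_mul]
          change _ = K * ‖v‖ * (∫ x, |fderiv ℝ φ x v| ∂ν) * dist s t
          ring
  have := norm_deriv_le_of_lipschitz (x₀ := (0 : ℝ)) hlip
  rw [(hφ.hasDerivAt_smear_fderiv_line hf v).deriv] at this
  exact (le_abs_self _).trans this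

end SecondOrder

/-! ### Gaussian kernels -/

section GaussianKernel

open scoped RealInnerProductSpace

variable {E : Type*} [NormedAddCommGroup E] [InnerProductSpace ℝ E]

theorem expDecay_of_le_gaussian {E F : Type*} [NormedAddCommGroup E] [NormedAddCommGroup F]
    {φ : E → F} {D m : ℝ}
    (hD : 0 ≤ D) (hm : 0 < m) (a : E)
    (h : ∀ x, ‖φ x‖ ≤ D * ((1 + ‖x - a‖) ^ 2 * Real.exp (-(m * ‖x - a‖ ^ 2) / 2))) :
    ExpDecay φ := by
  refine ⟨D * Real.exp (8 / m + 2 * ‖a‖), by positivity, fun x => (h x).trans ?_⟩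
  rw [mul_assoc, ← Real.exp_add]
  refine mul_le_mul_of_nonneg_left ?_ hD
  set t := ‖x - a‖
  have ht : 0 ≤ t := norm_nonneg _
  have h1 : (1 + t) ^ 2 ≤ Real.exp (2 * t) := by
    rw [two_mul, Real.exp_add, ← sq]
    exact pow_le_pow_left₀ (by positivity) (by linarith [Real.add_one_le_exp t]) 2
  have h2 : ‖x‖ ≤ t + ‖a‖ := by
    linarith [norm_sub_norm_le x a]
  -- Completing the square: `4 t - m t² / 2 ≤ 8 / m`.
  have h3 : 4 * t - m * t ^ 2 / 2 ≤ 8 / m := by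
    rw [le_div_iff₀ hm]
    nlinarith [sq_nonneg (m * t - 4)]
  calc (1 + t) ^ 2 * Real.exp (-(m * t ^ 2) / 2)
      ≤ Real.exp (2 * t) * Real.exp (-(m * t ^ 2) / 2) := by gcongr
    _ = Real.exp (2 * t - m * t ^ 2 / 2) := by rw [← Real.exp_add]; ring_nf
    _ ≤ _ := Real.exp_le_exp.2 (by linarith)

/-- The bilinear form `(u, v) ↦ ⟪T u, v⟫`. -/
noncomputable def innerForm (T : E →L[ℝ] E) : E →L[ℝ] E →L[ℝ] ℝ := innerSL ℝ ∘L T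

@[simp]
theorem innerForm_apply (T : E →L[ℝ] E) (u v : E) : innerForm T u v = ⟪T u, v⟫ := rfl

variable (T : E →L[ℝ] E) (c : ℝ) (a : E)

/-- The Gaussian bump `x ↦ c exp (-⟪T (x - a), x - a⟫ / 2)`. -/
noncomputable def gaussianBump (x : E) : ℝ := c * Real.exp (-⟪T (x - a), x - a⟫ / 2)

variable {T}

theorem hasFDerivAt_gaussianBump (hT : T.toLinearMap.IsSymmetric) (x : E) :
    HasFDerivAt (gaussianBump T c a) (-gaussianBump T c a x • innerForm T (x - a)) x := by
  have h1 : HasFDerivAt (fun x : E => x - a) (.id ℝ E) x := (hasFDerivAt_id x).sub_const a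
  have h2 : HasFDerivAt (fun x : E => T (x - a)) T x := T.hasFDerivAt.comp x h1
  have h3 := (((h2.inner ℝ h1).const_mul (-1 / 2)).exp).const_mul c
  have he : gaussianBump T c a = fun x => c * Real.exp (-1 / 2 * ⟪T (x - a), x - a⟫) := by
    funext x
    rw [gaussianBump]
    congr 2
    ring
  rw [he]
  refine h3.congr_fderiv ?_
  ext v
  have hs : ⟪T v, x - a⟫ = ⟪T (x - a), v⟫ := by
    rw [real_inner_comm]; exact (hT (x - a) v).symm
  simp [hs, -map_sub]
  ring

theorem fderiv_gaussianBump (hT : T.toLinearMap.IsSymmetric) :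
    fderiv ℝ (gaussianBump T c a) =
      fun x => -gaussianBump T c a x • innerForm T (x - a) :=
  funext fun x => (hasFDerivAt_gaussianBump c a hT x).fderiv

theorem fderiv_gaussianBump_apply (hT : T.toLinearMap.IsSymmetric) (x v : E) :
    fderiv ℝ (gaussianBump T c a) x v = -(gaussianBump T c a x * ⟪T (x - a), v⟫) := by
  simp [fderiv_gaussianBump c a hT, -map_sub]

theorem hasFDerivAt_fderiv_gaussianBump (hT : T.toLinearMap.IsSymmetric) (x : E) :
    HasFDerivAt (fderiv ℝ (gaussianBump T c a))
      (gaussianBump T c a x • ((innerForm T (x - a)).smulRight (innerForm T (x - a)) -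
        innerForm T)) x := by
  rw [fderiv_gaussianBump c a hT]
  have h1 : HasFDerivAt (fun x : E => x - a) (.id ℝ E) x := (hasFDerivAt_id x).sub_const a
  have h2 : HasFDerivAt (fun x : E => innerForm T (x - a)) (innerForm T) x :=
    (innerForm T).hasFDerivAt.comp x h1
  refine ((hasFDerivAt_gaussianBump c a hT x).fun_neg.smul h2).congr_fderiv ?_
  ext u v
  simp [-map_sub]
  ring

theorem fderiv_fderiv_gaussianBump_apply (hT : T.toLinearMap.IsSymmetric) (x u v : E) :
    fderiv ℝ (fderiv ℝ (gaussianBump T c a)) x u v =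
      gaussianBump T c a x * (⟪T (x - a), u⟫ * ⟪T (x - a), v⟫ - ⟪T u, v⟫) := by
  rw [(hasFDerivAt_fderiv_gaussianBump c a hT x).fderiv]
  simp [-map_sub]

theorem decayingC2_gaussianBump (hT : T.toLinearMap.IsSymmetric) {m : ℝ} (hm : 0 < m)
    (hTm : ∀ y, m * ‖y‖ ^ 2 ≤ ⟪T y, y⟫) : DecayingC2 (gaussianBump T c a) := by
  have hg : ∀ x, |gaussianBump T c a x| ≤ |c| * Real.exp (-(m * ‖x - a‖ ^ 2) / 2) := fun x => by
    rw [gaussianBump, abs_mul, Real.abs_exp]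
    gcongr
    exact hTm _
  have hLx : ∀ y, ‖innerForm T y‖ ≤ ‖T‖ * ‖y‖ := fun y =>
    (innerSL_apply_norm ℝ (T y)).trans_le (T.le_opNorm y)
  have hL : ‖innerForm T‖ ≤ ‖T‖ := ContinuousLinearMap.opNorm_le_bound _ (norm_nonneg _) hLx
  have hD : 0 ≤ |c| * (1 + ‖T‖) ^ 2 := by positivity
  -- All three bounds have the form `|c| * e * w ≤ |c| * (1 + ‖T‖)² * ((1 + t)² * e)`.
  have key : ∀ t e w : ℝ, 0 ≤ e → w ≤ (1 + ‖T‖) ^ 2 * (1 + t) ^ 2 →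
      |c| * e * w ≤ |c| * (1 + ‖T‖) ^ 2 * ((1 + t) ^ 2 * e) := fun t e w he hw => by
    calc |c| * e * w ≤ |c| * e * ((1 + ‖T‖) ^ 2 * (1 + t) ^ 2) := by gcongr
      _ = _ := by ring
  have hT0 := norm_nonneg T
  refine ⟨?_, expDecay_of_le_gaussian hD hm a fun x => ?_,
    expDecay_of_le_gaussian hD hm a fun x => ?_, expDecay_of_le_gaussian hD hm a fun x => ?_⟩
  · have h1 : ContDiff ℝ 2 fun x => ⟪T (x - a), x - a⟫ :=
      ContDiff.inner ℝ (by fun_prop) (by fun_prop)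
    unfold gaussianBump
    fun_prop
  · have ht := norm_nonneg (x - a)
    refine le_trans ?_ (key _ _ 1 (Real.exp_pos _).le ?_)
    · simpa using hg x
    · nlinarith [mul_nonneg hT0 ht]
  · have ht := norm_nonneg (x - a)
    refine le_trans ?_ (key _ _ (‖T‖ * ‖x - a‖) (Real.exp_pos _).le ?_)
    · rw [fderiv_gaussianBump c a hT, norm_smul, norm_neg, Real.norm_eq_abs]
      exact mul_le_mul (hg x) (hLx _) (norm_nonneg _) (by positivity)
    · have h0 := mul_nonneg hT0 ht
      nlinarith
  · have ht := norm_nonneg (x - a)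
    refine le_trans ?_ (key _ _ ((‖T‖ * ‖x - a‖) * (‖T‖ * ‖x - a‖) + ‖T‖) (Real.exp_pos _).le ?_)
    · rw [(hasFDerivAt_fderiv_gaussianBump c a hT x).fderiv]
      refine (ContinuousLinearMap.opNorm_smul_le _ _).trans ?_
      refine mul_le_mul (hg x) ((norm_sub_le _ _).trans (add_le_add ?_ hL))
        (ContinuousLinearMap.opNorm_nonneg _) (by positivity)
      rw [ContinuousLinearMap.norm_smulRight_apply]
      exact mul_le_mul (hLx _) (hLx _) (norm_nonneg _) (by positivity)
    · have h0 := mul_nonneg hT0 ht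
      nlinarith

variable [FiniteDimensional ℝ E] [MeasurableSpace E] [BorelSpace E]
  {ν : Measure E} [ν.IsAddHaarMeasure]

/-- The second moments of a Gaussian, read off from `∫ g'' = 0`. -/
theorem integral_gaussianBump_mul_sq (hT : T.toLinearMap.IsSymmetric) {m : ℝ} (hm : 0 < m)
    (hTm : ∀ y, m * ‖y‖ ^ 2 ≤ ⟪T y, y⟫) (v : E) :
    Integrable (fun x => gaussianBump T c a x * ⟪T (x - a), v⟫ ^ 2) ν ∧
    ∫ x, gaussianBump T c a x * ⟪T (x - a), v⟫ ^ 2 ∂ν =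
      ⟪T v, v⟫ * ∫ x, gaussianBump T c a x ∂ν := by
  have hg := decayingC2_gaussianBump c a hT hm hTm
  have hi := hg.decay.integrable ν hg.contDiff.continuous
  have hi2 : Integrable (fun x => fderiv ℝ (fderiv ℝ (gaussianBump T c a)) x v v) ν :=
    ((hg.decay_fderiv_fderiv.integrable ν
      hg.continuous_fderiv_fderiv).apply_continuousLinearMap v).apply_continuousLinearMap v
  -- Smearing the constant `1` gives a constant function, whose second derivative vanishes.
  have h1 : LipschitzWith 0 (fun _ : E => (1 : ℝ)) := LipschitzWith.const _
  have hz := hg.smear_fderiv_fderiv_apply (ν := ν) h1 v v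
  have hc : smear ν (fun _ => (1 : ℝ)) (gaussianBump T c a) =
      fun _ => ∫ x, gaussianBump T c a x ∂ν := by
    funext h
    simp [smear_eq_integral_comp_add]
  rw [← hg.fderiv_fderiv_smear h1, hc] at hz
  have hs : (fun x => gaussianBump T c a x * ⟪T (x - a), v⟫ ^ 2) = fun x =>
      fderiv ℝ (fderiv ℝ (gaussianBump T c a)) x v v + ⟪T v, v⟫ * gaussianBump T c a x := by
    funext x
    rw [fderiv_fderiv_gaussianBump_apply c a hT]
    ring
  rw [hs]
  refine ⟨hi2.add (hi.const_mul _), ?_⟩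
  rw [integral_add hi2 (hi.const_mul _), integral_const_mul]
  simp at hz
  rw [← hz, zero_add]

/-- For a normalized Gaussian bump `g`, this follows from the bound `K ‖v‖ ∫ |g' v|` by the
arithmetic-geometric mean inequality and the second moments. -/
theorem smear_fderiv_fderiv_gaussianBump_le (hT : T.toLinearMap.IsSymmetric) {m : ℝ} (hm : 0 < m)
    (hTm : ∀ y, m * ‖y‖ ^ 2 ≤ ⟪T y, y⟫) (hc : 0 ≤ c) (h1 : ∫ x, gaussianBump T c a x ∂ν = 1)
    {f : E → ℝ} {K : ℝ≥0} (hf : LipschitzWith K f) (v : E) :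
    smear ν f (fderiv ℝ (fderiv ℝ (gaussianBump T c a))) 0 v v ≤
      K / 2 * (‖v‖ ^ 2 + ⟪T v, v⟫) := by
  have hg := decayingC2_gaussianBump c a hT hm hTm
  obtain ⟨hi2, h2⟩ := integral_gaussianBump_mul_sq (ν := ν) c a hT hm hTm v
  have hi := hg.decay.integrable ν hg.contDiff.continuous
  have hiv : Integrable (fun x => |fderiv ℝ (gaussianBump T c a) x v|) ν :=
    ((hg.decay_fderiv.integrable ν
      (hg.contDiff.continuous_fderiv two_ne_zero)).apply_continuousLinearMap v).abs
  refine (hg.smear_fderiv_fderiv_le hf v).trans ?_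
  have h3 : ‖v‖ * ∫ x, |fderiv ℝ (gaussianBump T c a) x v| ∂ν ≤
      ∫ x, (‖v‖ ^ 2 / 2 * gaussianBump T c a x +
        1 / 2 * (gaussianBump T c a x * ⟪T (x - a), v⟫ ^ 2)) ∂ν := by
    rw [← integral_const_mul]
    refine integral_mono (hiv.const_mul _) ((hi.const_mul _).add (hi2.const_mul _)) fun x => ?_
    have hg0 : 0 ≤ gaussianBump T c a x := mul_nonneg hc (Real.exp_pos _).le
    simp only
    rw [fderiv_gaussianBump_apply c a hT, abs_neg, abs_mul, abs_of_nonneg hg0,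
      ← sq_abs ⟪T (x - a), v⟫]
    nlinarith [mul_nonneg hg0 (sq_nonneg (‖v‖ - |⟪T (x - a), v⟫|))]
  rw [integral_add (hi.const_mul _) (hi2.const_mul _), integral_const_mul, integral_const_mul, h2,
    h1] at h3
  calc (K : ℝ) * ‖v‖ * ∫ x, |fderiv ℝ (gaussianBump T c a) x v| ∂ν
      = K * (‖v‖ * ∫ x, |fderiv ℝ (gaussianBump T c a) x v| ∂ν) := by ring
    _ ≤ K * (‖v‖ ^ 2 / 2 * 1 + 1 / 2 * (⟪T v, v⟫ * 1)) := by gcongr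
    _ = _ := by ring

end GaussianKernel

/-! ### Hessian matrices -/

section Hessian

variable {d : ℕ} {x : EuclideanSpace ℝ (Fin d)}

theorem dotProduct_hessian_mulVec (g : EuclideanSpace ℝ (Fin d) → ℝ)
    (x v : EuclideanSpace ℝ (Fin d)) :
    v.ofLp ⬝ᵥ (hessian g x *ᵥ v.ofLp) = fderiv ℝ (fderiv ℝ g) x v v := by
  have hv : v = ∑ i, v.ofLp i • EuclideanSpace.single i (1 : ℝ) := by
    have := (EuclideanSpace.basisFun (Fin d) ℝ).sum_repr v
    simpa using this.symm
  conv_rhs => rw [hv]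
  simp only [map_sum, map_smul, _root_.sum_apply, _root_.smul_apply,
    dotProduct, mulVec, hessian, Matrix.of_apply, smul_eq_mul, Finset.mul_sum]
  rw [Finset.sum_comm]
  refine Finset.sum_congr rfl fun i _ => Finset.sum_congr rfl fun j _ => ?_
  ring

/-- The chain rule for an affine change of variables. -/
theorem hessian_const_add_mul_comp_smul_sub {G : EuclideanSpace ℝ (Fin d) → ℝ}
    (hG : Differentiable ℝ G) (hG' : Differentiable ℝ (fderiv ℝ G)) (b c t : ℝ)
    (a : EuclideanSpace ℝ (Fin d)) :
    hessian (fun z => b + c * G (t • (z - a))) x = (c * t ^ 2) • hessian G (t • (x - a)) := by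
  have hl : ∀ z : EuclideanSpace ℝ (Fin d),
      HasFDerivAt (fun z => t • (z - a)) (t • ContinuousLinearMap.id ℝ _) z := fun z =>
    ((hasFDerivAt_id z).sub_const a).const_smul t
  have h1 : fderiv ℝ (fun z => b + c * G (t • (z - a))) =
      fun z => (c * t) • fderiv ℝ G (t • (z - a)) := by
    funext z
    have := (((hG (t • (z - a))).hasFDerivAt.comp z (hl z)).const_mul c).const_add b
    refine (this.congr_fderiv ?_).fderiv
    ext v
    simp [mul_assoc]
  have h2 := (((hG' (t • (x - a))).hasFDerivAt.comp x (hl x)).const_smul (c * t))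
  ext i j
  simp only [hessian, h1, Matrix.of_apply, Matrix.smul_apply]
  have h3 : fderiv ℝ (fun z => (c * t) • fderiv ℝ G (t • (z - a))) x = _ := h2.fderiv
  rw [h3]
  simp
  ring

end Hessian

/-! ### The density of a multivariate Gaussian -/

section GaussianDensity

open scoped RealInnerProductSpace

variable {d : ℕ} (μ : EuclideanSpace ℝ (Fin d)) {S : Matrix (Fin d) (Fin d) ℝ}

theorem inner_toEuclideanCLM_self (M : Matrix (Fin d) (Fin d) ℝ) (y : EuclideanSpace ℝ (Fin d)) :
    ⟪toEuclideanCLM (𝕜 := ℝ) M y, y⟫ = y.ofLp ⬝ᵥ (M *ᵥ y.ofLp) := by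
  simp [EuclideanSpace.inner_eq_star_dotProduct]

theorem Matrix.PosDef.isSymmetric_toEuclideanCLM_inv (hS : S.PosDef) :
    (toEuclideanCLM (𝕜 := ℝ) S⁻¹).toLinearMap.IsSymmetric :=
  isSymmetric_toEuclideanLin_iff.2 hS.inv.isHermitian

theorem Matrix.PosDef.exists_pos_mul_sq_norm_le (hS : S.PosDef) :
    ∃ m : ℝ, 0 < m ∧ ∀ y, m * ‖y‖ ^ 2 ≤ ⟪toEuclideanCLM (𝕜 := ℝ) S y, y⟫ := by
  rcases subsingleton_or_nontrivial (Matrix (Fin d) (Fin d) ℝ) with h | h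
  · refine ⟨1, one_pos, fun y => le_of_eq ?_⟩
    rw [Subsingleton.elim S 1, map_one]
    simp
  · obtain ⟨m, hm, hle⟩ := (CFC.exists_pos_algebraMap_le_iff (a := S)
      hS.isHermitian).2 ((StarOrderedRing.isStrictlyPositive_iff_spectrum_pos S
        hS.isHermitian).1 hS.isStrictlyPositive)
    refine ⟨m, hm, fun y => ?_⟩
    have := (Matrix.le_iff.1 hle).dotProduct_mulVec_nonneg y.ofLp
    rw [Matrix.sub_mulVec, dotProduct_sub, Algebra.algebraMap_eq_smul_one, Matrix.smul_mulVec,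
      Matrix.one_mulVec, dotProduct_smul] at this
    rw [inner_toEuclideanCLM_self, EuclideanSpace.real_norm_sq_eq]
    simpa [dotProduct, sq] using this

theorem gaussianDensity_eq_gaussianBump (S : Matrix (Fin d) (Fin d) ℝ) :
    gaussianDensity μ S = gaussianBump (toEuclideanCLM (𝕜 := ℝ) S⁻¹)
      (Real.sqrt ((2 * Real.pi) ^ d * S.det))⁻¹ μ := by
  funext x
  rw [gaussianDensity, gaussianBump, inner_toEuclideanCLM_self]

theorem gaussianDensity_nonneg (S : Matrix (Fin d) (Fin d) ℝ) (x : EuclideanSpace ℝ (Fin d)) :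
    0 ≤ gaussianDensity μ S x := by
  unfold gaussianDensity
  positivity

theorem decayingC2_gaussianDensity (hS : S.PosDef) : DecayingC2 (gaussianDensity μ S) := by
  obtain ⟨m, hm, hle⟩ := hS.inv.exists_pos_mul_sq_norm_le
  rw [gaussianDensity_eq_gaussianBump]
  exact decayingC2_gaussianBump _ _ hS.isSymmetric_toEuclideanCLM_inv hm hle

theorem integral_multivariateGaussian (hS : S.PosDef) (F : EuclideanSpace ℝ (Fin d) → ℝ) :
    ∫ x, F x ∂(multivariateGaussian μ S) = ∫ x, gaussianDensity μ S x * F x := by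
  have hc := (decayingC2_gaussianDensity μ hS).contDiff.continuous
  rw [multivariateGaussian_eq_withDensity μ hS,
    integral_withDensity_eq_integral_toReal_smul (by fun_prop)
      (.of_forall fun _ => ENNReal.ofReal_lt_top)]
  simp [ENNReal.toReal_ofReal, gaussianDensity_nonneg]

theorem integral_gaussianDensity (hS : S.PosDef) : ∫ x, gaussianDensity μ S x = 1 := by
  have := integral_multivariateGaussian μ hS (fun _ => 1)
  simpa using this.symm

theorem fderiv_fderiv_gaussianDensity_comm (hS : S.PosDef)
    (x u v : EuclideanSpace ℝ (Fin d)) :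
    fderiv ℝ (fderiv ℝ (gaussianDensity μ S)) x u v =
      fderiv ℝ (fderiv ℝ (gaussianDensity μ S)) x v u :=
  (decayingC2_gaussianDensity μ hS).contDiff.contDiffAt.isSymmSndFDerivAt (by simp) u v

variable {f : EuclideanSpace ℝ (Fin d) → ℝ} {K : ℝ≥0}

/-- The averaged Hessian is the Hessian at the origin of the smeared function
`h ↦ E[f(X + h)]`. -/
theorem expectedHessian_eq_hessian_smear (hS : S.PosDef) (hf : LipschitzWith K f) :
    expectedHessian μ S f = hessian (smear volume f (gaussianDensity μ S)) 0 := by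
  have hg := decayingC2_gaussianDensity μ hS
  ext i j
  simp only [expectedHessian, hessian, Matrix.of_apply]
  rw [hg.fderiv_fderiv_smear hf, hg.smear_fderiv_fderiv_apply hf]

theorem isHermitian_expectedHessian (hS : S.PosDef) :
    (expectedHessian μ S f).IsHermitian := by
  refine Matrix.IsHermitian.ext fun i j => ?_
  simp only [expectedHessian, hessian, Matrix.of_apply,
    fderiv_fderiv_gaussianDensity_comm μ hS _ (EuclideanSpace.single i 1)]
  rfl

theorem dotProduct_expectedHessian_mulVec (hS : S.PosDef) (hf : LipschitzWith K f)
    (v : EuclideanSpace ℝ (Fin d)) :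
    v.ofLp ⬝ᵥ (expectedHessian μ S f *ᵥ v.ofLp) =
      smear volume f (fderiv ℝ (fderiv ℝ (gaussianDensity μ S))) 0 v v := by
  rw [expectedHessian_eq_hessian_smear μ hS hf, dotProduct_hessian_mulVec,
    (decayingC2_gaussianDensity μ hS).fderiv_fderiv_smear hf]

/-- One derivative is absorbed by the Lipschitz constant, the other by the Gaussian, whose
logarithmic gradient in direction `v` has second moment `vᵀ S⁻¹ v`. -/
theorem dotProduct_expectedHessian_mulVec_le (hS : S.PosDef) (hf : LipschitzWith K f)
    (v : EuclideanSpace ℝ (Fin d)) :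
    v.ofLp ⬝ᵥ (expectedHessian μ S f *ᵥ v.ofLp) ≤
      K / 2 * (‖v‖ ^ 2 + v.ofLp ⬝ᵥ (S⁻¹ *ᵥ v.ofLp)) := by
  obtain ⟨m, hm, hle⟩ := hS.inv.exists_pos_mul_sq_norm_le
  rw [dotProduct_expectedHessian_mulVec μ hS hf, ← inner_toEuclideanCLM_self]
  have h1 := integral_gaussianDensity μ hS
  rw [gaussianDensity_eq_gaussianBump] at h1 ⊢
  exact smear_fderiv_fderiv_gaussianBump_le _ _ hS.isSymmetric_toEuclideanCLM_inv hm hle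
    (by positivity) h1 hf v

/-- The averaged Hessian of a convex function is monotone in the averaging density. -/
theorem dotProduct_expectedHessian_mulVec_le_of_density_le (hconv : ConvexOn ℝ Set.univ f)
    (hf : LipschitzWith K f) {Q R : Matrix (Fin d) (Fin d) ℝ} (hS : S.PosDef) (hQ : Q.PosDef)
    (hR : R.PosDef) {a b : ℝ}
    (hle : ∀ x, gaussianDensity μ S x ≤ a * gaussianDensity μ Q x + b * gaussianDensity μ R x)
    (v : EuclideanSpace ℝ (Fin d)) :
    v.ofLp ⬝ᵥ (expectedHessian μ S f *ᵥ v.ofLp) ≤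
      a * (v.ofLp ⬝ᵥ (expectedHessian μ Q f *ᵥ v.ofLp)) +
        b * (v.ofLp ⬝ᵥ (expectedHessian μ R f *ᵥ v.ofLp)) := by
  rw [dotProduct_expectedHessian_mulVec μ hS hf, dotProduct_expectedHessian_mulVec μ hQ hf,
    dotProduct_expectedHessian_mulVec μ hR hf]
  exact smear_fderiv_fderiv_le_of_le hconv hf (decayingC2_gaussianDensity μ hS)
    (decayingC2_gaussianDensity μ hQ) (decayingC2_gaussianDensity μ hR) hle v

theorem Matrix.PosDef.sq_smul (hS : S.PosDef) {t : ℝ} (ht : 0 < t) : (t ^ 2 • S).PosDef :=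
  hS.smul (by positivity)

theorem Matrix.PosDef.inv_sq_smul (hS : S.PosDef) {t : ℝ} (ht : 0 < t) :
    (t ^ 2 • S)⁻¹ = (t ^ 2)⁻¹ • S⁻¹ := by
  have := Matrix.inv_smul' S (Units.mk0 (t ^ 2) (by positivity))
    (isUnit_iff_ne_zero.2 hS.det_pos.ne')
  simpa [Units.smul_def] using this

/-- The density of `N(μ, t² S)` in terms of the quadratic form of `S⁻¹`. -/
theorem gaussianDensity_sq_smul (hS : S.PosDef) {t : ℝ} (ht : 0 < t)
    (x : EuclideanSpace ℝ (Fin d)) :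
    gaussianDensity μ (t ^ 2 • S) x = (t ^ d)⁻¹ * (Real.sqrt ((2 * Real.pi) ^ d * S.det))⁻¹ *
      Real.exp (-((x - μ).ofLp ⬝ᵥ (S⁻¹ *ᵥ (x - μ).ofLp)) / (2 * t ^ 2)) := by
  have hdet : (2 * Real.pi) ^ d * (t ^ 2 • S).det =
      (t ^ d) ^ 2 * ((2 * Real.pi) ^ d * S.det) := by
    rw [Matrix.det_smul, Fintype.card_fin]
    ring
  rw [gaussianDensity, hdet, Real.sqrt_mul (by positivity), Real.sqrt_sq (by positivity), mul_inv,
    hS.inv_sq_smul ht, Matrix.smul_mulVec, dotProduct_smul]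
  congr 2
  simp only [smul_eq_mul]
  field_simp

theorem gaussianDensity_sq_smul_comp (hS : S.PosDef) {t : ℝ} (ht : 0 < t)
    (y : EuclideanSpace ℝ (Fin d)) :
    gaussianDensity μ (t ^ 2 • S) (t • y + μ) = (t ^ d)⁻¹ * gaussianDensity μ S (y + μ) := by
  rw [gaussianDensity_sq_smul μ hS ht, gaussianDensity, mul_assoc]
  congr 3
  simp only [add_sub_cancel_right, WithLp.ofLp_smul, Matrix.mulVec_smul, dotProduct_smul,
    smul_dotProduct, smul_eq_mul]
  field_simp

/-- The surrogate is, up to additive and multiplicative constants, `f` smeared by the density of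
`N(μ, (1 - lam)² S)`. -/
theorem surrogate_eq_smear (hS : S.PosDef) (hf : LipschitzWith K f) {lam : ℝ} (h1 : lam < 1)
    (z : EuclideanSpace ℝ (Fin d)) :
    surrogate lam μ S f z = (1 - 1 / lam) * (∫ x, gaussianDensity μ S x * f x) +
      1 / lam * smear volume f (gaussianDensity μ ((1 - lam) ^ 2 • S)) (lam • (z - μ)) := by
  have ht : 0 < 1 - lam := by linarith
  set t := 1 - lam with htdef
  have hg := decayingC2_gaussianDensity μ hS
  have hi1 : Integrable fun x => gaussianDensity μ S x * f x := by
    simpa [mul_comm] using hg.decay.integrable_smul volume hg.contDiff.continuous hf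
  have hlip : LipschitzWith (K * t.toNNReal) fun x => f (t • x + lam • z) := by
    refine LipschitzWith.of_dist_le_mul fun x y => ?_
    have := hf.dist_le_mul (t • x + lam • z) (t • y + lam • z)
    rw [dist_add_right, dist_smul₀, Real.norm_of_nonneg ht.le] at this
    simpa [Real.coe_toNNReal _ ht.le, mul_assoc] using this
  have hi2 : Integrable fun x => gaussianDensity μ S x * f (t • x + lam • z) := by
    simpa [mul_comm] using hg.decay.integrable_smul volume hg.contDiff.continuous hlip
  -- Substitute `x ↦ (1 - lam) • (x - μ) + μ`, which maps `N(μ, S)` to `N(μ, (1 - lam)² S)`.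
  have hsub : ∫ x, gaussianDensity μ S x * f (t • x + lam • z) =
      smear volume f (gaussianDensity μ (t ^ 2 • S)) (lam • (z - μ)) := by
    rw [smear_eq_integral_comp_add,
      ← integral_add_right_eq_self (fun x => f (x + lam • (z - μ)) • _) μ]
    have := Measure.integral_comp_smul (volume : Measure (EuclideanSpace ℝ (Fin d)))
      (fun x => f (x + μ + lam • (z - μ)) • gaussianDensity μ (t ^ 2 • S) (x + μ)) t
    rw [finrank_euclideanSpace_fin, abs_of_nonneg (by positivity), smul_eq_mul,
      eq_inv_mul_iff_mul_eq₀ (by positivity)] at this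
    rw [← this, ← integral_const_mul, ← integral_add_right_eq_self _ μ]
    refine integral_congr_ae (.of_forall fun x => ?_)
    have he : t • (x + μ) + lam • z = t • x + μ + lam • (z - μ) := by
      rw [htdef]
      module
    simp only [gaussianDensity_sq_smul_comp μ hS ht, he, smul_eq_mul]
    field_simp
  rw [surrogate, integral_multivariateGaussian μ hS]
  rw [← hsub, ← integral_const_mul, ← integral_const_mul,
    ← integral_add (hi1.const_mul _) (hi2.const_mul _)]
  refine integral_congr_ae (.of_forall fun x => ?_)
  simp only
  ring

theorem hessian_surrogate (hS : S.PosDef) (hf : LipschitzWith K f) {lam : ℝ} (h0 : 0 < lam)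
    (h1 : lam < 1) :
    hessian (surrogate lam μ S f) μ = lam • expectedHessian μ ((1 - lam) ^ 2 • S) f := by
  have hS' : ((1 - lam) ^ 2 • S).PosDef := hS.sq_smul (by linarith)
  have hg := decayingC2_gaussianDensity μ hS'
  rw [show surrogate lam μ S f = _ from funext fun z => surrogate_eq_smear μ hS hf h1 z,
    hessian_const_add_mul_comp_smul_sub, expectedHessian_eq_hessian_smear μ hS' hf]
  · simp only [sub_self, smul_zero]
    congr 1
    field_simp
  · exact fun h => (hg.hasFDerivAt_smear hf h).differentiableAt
  · rw [hg.fderiv_smear hf]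
    exact fun h => (hg.hasFDerivAt_smear_fderiv hf h).differentiableAt.neg

end GaussianDensity

/-! ### Comparison of Gaussian densities and the choice of the constant -/

/-- The density of `N(μ, S)` is dominated by twice the density of the slightly contracted Gaussian
`N(μ, (1 - lam)² S)` where the Mahalanobis distance squared is at most `1 / (8 lam)`, and by a tiny
multiple of the density of the dilated Gaussian `N(μ, 4 S)` elsewhere. -/
theorem gaussianDensity_le_contracted_add_dilated {d : ℕ} (μ : EuclideanSpace ℝ (Fin d))
    {S : Matrix (Fin d) (Fin d) ℝ} (hS : S.PosDef) {lam : ℝ} (h0 : 0 < lam) (h1 : lam ≤ 1 / 2)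
    (x : EuclideanSpace ℝ (Fin d)) :
    gaussianDensity μ S x ≤ 2 * gaussianDensity μ ((1 - lam) ^ 2 • S) x +
      2 ^ d * Real.exp (-(3 / (64 * lam))) * gaussianDensity μ ((2 : ℝ) ^ 2 • S) x := by
  have ht : 0 < 1 - lam := by linarith
  rw [gaussianDensity_sq_smul μ hS ht, gaussianDensity_sq_smul μ hS two_pos, gaussianDensity]
  set c := (Real.sqrt ((2 * Real.pi) ^ d * S.det))⁻¹
  have hc : 0 ≤ c := by positivity
  set u := (x - μ).ofLp ⬝ᵥ (S⁻¹ *ᵥ (x - μ).ofLp)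
  have hu : 0 ≤ u := by
    simpa only [star_trivial] using hS.inv.posSemidef.dotProduct_mulVec_nonneg (x - μ).ofLp
  rcases le_total (8 * lam * u) 1 with h | h
  · have hexp : -u / 2 ≤ 1 / 2 + -u / (2 * (1 - lam) ^ 2) := by
      have h2 : u * (1 - (1 - lam) ^ 2) ≤ (1 - lam) ^ 2 := by
        nlinarith [mul_nonneg hu h0.le, mul_nonneg (mul_nonneg hu h0.le) h0.le]
      have h3 : u / (2 * (1 - lam) ^ 2) ≤ 1 / 2 + u / 2 := by
        rw [div_le_iff₀ (by positivity)]
        nlinarith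
      rw [neg_div, neg_div]
      linarith
    have hhalf : Real.exp (1 / 2) ≤ 2 := by
      have h4 : Real.exp (1 / 2) * Real.exp (1 / 2) = Real.exp 1 := by
        rw [← Real.exp_add]
        norm_num
      nlinarith [Real.exp_one_lt_d9, Real.exp_pos (1 / 2)]
    have hpow : 1 ≤ ((1 - lam) ^ d)⁻¹ :=
      (one_le_inv₀ (by positivity)).2 (pow_le_one₀ ht.le (by linarith))
    calc c * Real.exp (-u / 2)
        ≤ c * (Real.exp (1 / 2) * Real.exp (-u / (2 * (1 - lam) ^ 2))) := by
          rw [← Real.exp_add]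
          gcongr
      _ ≤ c * (2 * (((1 - lam) ^ d)⁻¹ * Real.exp (-u / (2 * (1 - lam) ^ 2)))) := by
          gcongr
          exact le_mul_of_one_le_left (Real.exp_pos _).le hpow
      _ = 2 * (((1 - lam) ^ d)⁻¹ * c * Real.exp (-u / (2 * (1 - lam) ^ 2))) := by ring
      _ ≤ _ := le_add_of_nonneg_right (by positivity)
  · have hexp : -u / 2 ≤ -(3 / (64 * lam)) + -u / (2 * 2 ^ 2) := by
      have : 3 / (64 * lam) ≤ 3 / 8 * u := by
        rw [div_le_iff₀ (by positivity)]
        linarith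
      linarith
    calc c * Real.exp (-u / 2)
        ≤ c * (Real.exp (-(3 / (64 * lam))) * Real.exp (-u / (2 * 2 ^ 2))) := by
          rw [← Real.exp_add]
          gcongr
      _ = 2 ^ d * Real.exp (-(3 / (64 * lam))) *
            (((2 : ℝ) ^ d)⁻¹ * c * Real.exp (-u / (2 * 2 ^ 2))) := by
          field_simp
      _ ≤ _ := le_add_of_nonneg_left (by positivity)

/-- With `M = max(n, d, 1/δ)`, the bound on `lam` makes the weight `2 ^ d exp (-3 / (64 lam))` of
the dilated Gaussian at most `exp (-|A|) M ^ (-(k + 1))`, which beats `K ≤ A M ^ k` by the factor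
`M⁻¹ ≤ δ`. -/
theorem dilated_weight_le (A : ℝ) (k : ℕ) {C : ℝ} (hC : 8 * (|A| + k + 2) ≤ C) {d n : ℕ}
    {δ lam K : ℝ} (hd : 1 ≤ d) (hδ : 0 < δ)
    (hK : K ≤ A * (max (max (n : ℝ) (d : ℝ)) (1 / δ)) ^ k) (h0 : 0 < lam)
    (hlam : lam ≤ 1 / ((d : ℝ) * logFactor C n d δ ^ 2)) :
    lam ≤ 1 / 2 ∧ K * (2 ^ d * Real.exp (-(3 / (64 * lam)))) ≤ δ := by
  rw [logFactor] at hlam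
  set M := max (max (n : ℝ) (d : ℝ)) (1 / δ)
  set l := Real.log M
  have hd' : (1 : ℝ) ≤ d := by exact_mod_cast hd
  have hM1 : 1 ≤ M := hd'.trans ((le_max_right _ _).trans (le_max_left _ _))
  have hMδ : 1 / δ ≤ M := le_max_right _ _
  have hl : 0 ≤ l := Real.log_nonneg hM1
  have hA := abs_nonneg A
  set a := |A| + k + 2 with ha
  have ha2 : 2 ≤ a := by
    have : (0 : ℝ) ≤ k := by positivity
    linarith
  have hL2 : 128 * (a * (1 + l)) ≤ (C * (1 + l)) ^ 2 := by
    have h1 : 64 * a ^ 2 ≤ C ^ 2 := by nlinarith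
    calc 128 * (a * (1 + l)) ≤ 64 * a ^ 2 * (1 + l) := by
          nlinarith [mul_nonneg hl (zero_le_two.trans ha2)]
      _ ≤ C ^ 2 * (1 + l) := by gcongr
      _ ≤ C ^ 2 * (1 + l) ^ 2 := by
          gcongr
          nlinarith
      _ = _ := by ring
  have hal : 2 ≤ a * (1 + l) := by nlinarith
  have hpos : 0 < (d : ℝ) * (C * (1 + l)) ^ 2 := by nlinarith
  have hinv : (d : ℝ) * (C * (1 + l)) ^ 2 ≤ 1 / lam := by
    rw [le_div_iff₀ h0, mul_comm]
    exact (le_div_iff₀ hpos).1 hlam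
  have hinv2 : (d : ℝ) * (128 * (a * (1 + l))) ≤ 1 / lam :=
    (mul_le_mul_of_nonneg_left hL2 (by positivity)).trans hinv
  refine ⟨?_, ?_⟩
  · rw [le_div_iff₀ two_pos, mul_comm, ← le_div_iff₀ h0]
    nlinarith
  have hexp : (d : ℝ) - 3 / (64 * lam) ≤ -|A| - (k + 1) * l := by
    have e : 3 / (64 * lam) = 3 / 64 * (1 / lam) := by field_simp
    rw [e]
    have h3 : (d : ℝ) - 3 / 64 * (1 / lam) ≤ d * (1 - 6 * (a * (1 + l))) := by linarith
    have h4 : (d : ℝ) * (1 - 6 * (a * (1 + l))) ≤ 1 * (1 - 6 * (a * (1 + l))) :=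
      mul_le_mul_of_nonpos_right hd' (by linarith)
    have h5 : |A| + (k + 1) * l ≤ a * (1 + l) := by
      have : (0 : ℝ) ≤ k := by positivity
      rw [ha]
      nlinarith [mul_nonneg hA hl]
    linarith
  have hε : 2 ^ d * Real.exp (-(3 / (64 * lam))) ≤ Real.exp (-|A|) * (M ^ (k + 1))⁻¹ := by
    have h2 : (2 : ℝ) ^ d ≤ Real.exp d := by
      have : (2 : ℝ) ≤ Real.exp 1 := by linarith [Real.add_one_le_exp (1 : ℝ)]
      calc (2 : ℝ) ^ d ≤ Real.exp 1 ^ d := by gcongr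
        _ = Real.exp d := by rw [← Real.exp_nat_mul, mul_one]
    have hM : (M ^ (k + 1))⁻¹ = Real.exp (-((k + 1) * l)) := by
      rw [Real.exp_neg]
      congr 1
      have := Real.exp_nat_mul l (k + 1)
      rw [Real.exp_log (by linarith)] at this
      rw [← this]
      push_cast
      rfl
    calc 2 ^ d * Real.exp (-(3 / (64 * lam)))
        ≤ Real.exp d * Real.exp (-(3 / (64 * lam))) := by gcongr
      _ = Real.exp (d - 3 / (64 * lam)) := by rw [← Real.exp_add, sub_eq_add_neg]
      _ ≤ Real.exp (-|A| - (k + 1) * l) := Real.exp_le_exp.2 hexp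
      _ = _ := by rw [hM, ← Real.exp_add, sub_eq_add_neg]
  have hAe : |A| * Real.exp (-|A|) ≤ 1 := by
    rw [Real.exp_neg, ← div_eq_mul_inv, div_le_one (Real.exp_pos _)]
    linarith [Real.add_one_le_exp |A|]
  have hM0 : 0 < M := by linarith
  calc K * (2 ^ d * Real.exp (-(3 / (64 * lam))))
      ≤ (|A| * M ^ k) * (2 ^ d * Real.exp (-(3 / (64 * lam)))) := by
        gcongr
        exact hK.trans (by gcongr; exact le_abs_self A)
    _ ≤ (|A| * M ^ k) * (Real.exp (-|A|) * (M ^ (k + 1))⁻¹) := by gcongr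
    _ = (|A| * Real.exp (-|A|)) * M⁻¹ := by
        rw [pow_succ]
        field_simp
    _ ≤ 1 * M⁻¹ := by gcongr
    _ ≤ δ := by
        rw [one_mul]
        exact inv_le_of_inv_le₀ hδ (by simpa using hMδ)

theorem mainTheorem6 (A : ℝ) (k : ℕ) :
    ∃ C₀ : ℝ, 0 < C₀ ∧ ∀ C : ℝ, C₀ ≤ C →
      ∀ (d n : ℕ) (δ lam : ℝ) (μ : EuclideanSpace ℝ (Fin d)) (S : Matrix (Fin d) (Fin d) ℝ)
        (f : EuclideanSpace ℝ (Fin d) → ℝ) (K : ℝ≥0),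
        1 ≤ d → 0 < δ →
        S.PosDef → S⁻¹ ≤ (1 / δ) • (1 : Matrix (Fin d) (Fin d) ℝ) →
        ConvexOn ℝ Set.univ f → LipschitzWith K f →
        (K : ℝ) ≤ A * (max (max (n : ℝ) (d : ℝ)) (1 / δ)) ^ k →
        0 < lam → lam ≤ 1 / ((d : ℝ) * logFactor C n d δ ^ 2) →
        expectedHessian μ S f ≤
          (2 / lam) • hessian (surrogate lam μ S f) μ +
            δ • (S⁻¹ + (1 : Matrix (Fin d) (Fin d) ℝ)) := by
  refine ⟨8 * (|A| + k + 2), by positivity, ?_⟩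
  intro C hC d n δ lam μ S f K hd hδ hS _ hconv hf hK h0 hlam
  obtain ⟨hhalf, hε⟩ := dilated_weight_le A k hC hd hδ hK h0 hlam
  have h1 : lam < 1 := by linarith
  have hQ : ((1 - lam) ^ 2 • S).PosDef := hS.sq_smul (by linarith)
  have hR : ((2 : ℝ) ^ 2 • S).PosDef := hS.sq_smul two_pos
  rw [hessian_surrogate μ hS hf h0 h1, smul_smul, div_mul_cancel₀ _ h0.ne', Matrix.le_iff]
  refine .of_dotProduct_mulVec_nonneg ?_ fun w => ?_
  · exact (((isHermitian_expectedHessian μ hQ).smul (.all _)).add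
      ((hS.inv.isHermitian.add Matrix.isHermitian_one).smul (.all _))).sub
      (isHermitian_expectedHessian μ hS)
  set v : EuclideanSpace ℝ (Fin d) := WithLp.toLp 2 w
  have hcmp := dotProduct_expectedHessian_mulVec_le_of_density_le μ hconv hf hS hQ hR
    (gaussianDensity_le_contracted_add_dilated μ hS h0 hhalf) v
  -- The dilation by `2` only shrinks the precision matrix, `(4 S)⁻¹ = S⁻¹ / 4`.
  have hbound := dotProduct_expectedHessian_mulVec_le μ hR hf v
  rw [hS.inv_sq_smul two_pos, Matrix.smul_mulVec, dotProduct_smul, smul_eq_mul] at hbound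
  have hv : ‖v‖ ^ 2 = w ⬝ᵥ w := by
    rw [EuclideanSpace.real_norm_sq_eq]
    simp [v, dotProduct, sq]
  rw [hv] at hbound
  have hw : 0 ≤ w ⬝ᵥ w := hv ▸ sq_nonneg _
  have hu : 0 ≤ w ⬝ᵥ (S⁻¹ *ᵥ w) := by
    simpa using hS.inv.posSemidef.dotProduct_mulVec_nonneg w
  simp only [star_trivial, Matrix.sub_mulVec, Matrix.add_mulVec, Matrix.smul_mulVec,
    Matrix.one_mulVec, dotProduct_sub, dotProduct_add, dotProduct_smul, smul_eq_mul]
  change w ⬝ᵥ (_ *ᵥ w) ≤ 2 * (w ⬝ᵥ (_ *ᵥ w)) + _ * (w ⬝ᵥ (_ *ᵥ w)) at hcmp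
  change w ⬝ᵥ (_ *ᵥ w) ≤ K / 2 * (w ⬝ᵥ w + _ * (w ⬝ᵥ (S⁻¹ *ᵥ w))) at hbound
  set ε := 2 ^ d * Real.exp (-(3 / (64 * lam)))
  have hε0 : 0 ≤ ε := by positivity
  have hfar : ε * (w ⬝ᵥ (expectedHessian μ ((2 : ℝ) ^ 2 • S) f *ᵥ w)) ≤
      δ * (w ⬝ᵥ (S⁻¹ *ᵥ w) + w ⬝ᵥ w) := by
    have hX : 0 ≤ w ⬝ᵥ w + ((2 : ℝ) ^ 2)⁻¹ * (w ⬝ᵥ (S⁻¹ *ᵥ w)) := by positivity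
    calc _ ≤ ε * (K / 2 * (w ⬝ᵥ w + ((2 : ℝ) ^ 2)⁻¹ * (w ⬝ᵥ (S⁻¹ *ᵥ w)))) := by gcongr
      _ = K * ε * ((w ⬝ᵥ w + ((2 : ℝ) ^ 2)⁻¹ * (w ⬝ᵥ (S⁻¹ *ᵥ w))) / 2) := by ring
      _ ≤ δ * ((w ⬝ᵥ w + ((2 : ℝ) ^ 2)⁻¹ * (w ⬝ᵥ (S⁻¹ *ᵥ w))) / 2) := by gcongr
      _ ≤ _ := by
        gcongr
        linarith
  exact sub_nonneg.2 (hcmp.trans (add_le_add le_rfl hfar))
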